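/- Let $A$ be a finite alphabet. For a finite word $u$ over $A$ and $a\in A$, write $|u|_a$ for the number of occurrences of $a$ in $u$. An infinite sequence $(a_n)_{n\in\mathbb N}$ over $A$ is called \emph{morphic} if there are a finite alphabet $B$, a letter $b\in B$, a word $w\in B^*$, a monoid morphism $\phi:B^*\to B^*$ that is non-erasing (no letter is mapped to the empty word) with $\phi(b)=bw$, and a coding $\psi:B^*\to A^*$ (a morphism mapping every letter to a single letter) such that $(a_n)_{n\in\mathbb N}=\lim_{i\to\infty}\psi(\phi^i(b))$; that is, for every $n$ and all sufficiently large $i$, the word $\psi(\phi^i(b))$ has a letter at position $n$ (counting from $0$), and it equals $a_n$. \textbf{Theorem.} Let $(a_n)_{n\in\mathbb N}$ be a sequence over a finite alphabet $A$, and write $a[0,N]=a_0a_1\cdots a_N$. Suppose there are a letter $a\in A$ and real numbers $0<\gamma<1$ and $C>0$ such that $$|a[0,N]|_a\sim C\,\frac{N}{(\log N)^{\gamma}}\qquad(N\to\infty).$$ Then $(a_n)_{n\in\mathbb N}$ is not morphic. -/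

import Mathlib

open Filter Asymptotics

/-- A morphism of free monoids is `k`-uniform if it sends every letter to a word of length `k`. -/
def IsUniformMorphism {A B : Type*} (k : ℕ) (φ : FreeMonoid A →* FreeMonoid B) : Prop :=
  ∀ a : A, (φ (FreeMonoid.of a)).length = k

/-- A coding is a `1`-uniform morphism. -/
def IsCoding {A B : Type*} (φ : FreeMonoid A →* FreeMonoid B) : Prop :=
  IsUniformMorphism 1 φ

/-- A morphism is non-erasing if no letter is sent to the empty word. -/
def IsNonErasing {A B : Type*} (φ : FreeMonoid A →* FreeMonoid B) : Prop :=
  ∀ a : A, φ (FreeMonoid.of a) ≠ 1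

/-- The finite words `u i` converge to the infinite word `s`: for every position `n`, for all large
`i` the word `u i` has a letter at position `n` and this letter is `s n`. -/
def WordsTendsto {A : Type*} (u : ℕ → FreeMonoid A) (s : ℕ → A) : Prop :=
  ∀ n : ℕ, ∀ᶠ i in atTop, (FreeMonoid.toList (u i))[n]? = some (s n)

/-- The sequence `s` is morphic: it is the limit of `ψ (φ^i (b))` for a non-erasing morphism `φ` on
a finite alphabet `B` with `φ b = b w`, and a coding `ψ`. Every finite set is in bijection with one
in `Type`, so taking `B : Type` is no restriction. -/
def IsMorphic {A : Type*} (s : ℕ → A) : Prop :=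
  ∃ (B : Type) (_ : Finite B) (b : B) (w : FreeMonoid B)
    (φ : FreeMonoid B →* FreeMonoid B) (ψ : FreeMonoid B →* FreeMonoid A),
    IsNonErasing φ ∧ IsCoding ψ ∧
    φ (FreeMonoid.of b) = FreeMonoid.of b * w ∧
    WordsTendsto (fun i => ψ ((⇑φ)^[i] (FreeMonoid.of b))) s

/-- The prefix `s[0,N] = s 0 s 1 ⋯ s N`, of length `N + 1`. -/
def prefixWord {A : Type*} (s : ℕ → A) (N : ℕ) : FreeMonoid A :=
  FreeMonoid.ofList ((List.range (N + 1)).map s)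

/-- The number `|w|_a` of occurrences of the letter `a` in the word `w`. -/
def letterCount {A : Type*} [DecidableEq A] (a : A) (w : FreeMonoid A) : ℕ :=
  (FreeMonoid.toList w).count a

/-! Along the iterates `φ^n b`, both the length and the number of occurrences of `a` (after coding)
are linear functionals of powers of the incidence matrix, hence exponential polynomials in `n` up to
finitely many terms. Each is thus eventually zero or has size `n ^ k * ρ ^ n` with `k` a natural
number. Oscillation of the dominant eigenvalues may spoil the lower bound at single `n`, but not
throughout a window of fixed length (`eventually_zero_or_growth`). The length is monotone, so it has
exact order `n ^ k * r ^ n` with `r ≥ 1`. Substituting it into `N / (log N) ^ γ`, the count would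
have order `r ^ n * n ^ (k - γ)` if `r > 1`, and `n ^ k * (log n) ^ (-γ)` if `r = 1`. These scales
are lexicographically ordered (`logScale_unique`), so the count's own scale `n ^ j * μ ^ n` must
coincide with one of them. This forces `j = k - γ` or `γ = 0`, impossible for `0 < γ < 1`. -/

/-! ### Exponential polynomials from powers of an operator -/

/-- If `v` is a generalized eigenvector of `T` for a nonzero eigenvalue `z`, then `ℓ (T ^ n v)` is
`z ^ n` times a polynomial in `n`. -/
theorem exists_eval_mul_pow_of_mem_maxGenEigenspace {V : Type*} [AddCommGroup V] [Module ℂ V]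
    (T : Module.End ℂ V) (ℓ : V →ₗ[ℂ] ℂ) {z : ℂ} (hz : z ≠ 0) {v : V}
    (hv : v ∈ T.maxGenEigenspace z) :
    ∃ p : Polynomial ℂ, ∀ᶠ n : ℕ in atTop, ℓ ((T ^ n) v) = p.eval (n : ℂ) * z ^ n := by
  obtain ⟨D, hD⟩ := (Module.End.mem_maxGenEigenspace T z v).1 hv
  set N : Module.End ℂ V := T - z • 1 with hN
  have hT : T = N + z • 1 := by simp [hN]
  have hN0 : ∀ m, D ≤ m → (N ^ m) v = 0 := by
    intro m hm
    obtain ⟨e, rfl⟩ := Nat.exists_eq_add_of_le' hm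
    rw [pow_add, Module.End.mul_apply, hD, map_zero]
  -- Expand `(N + z) ^ n` binomially: `n.choose m` is a falling factorial over `m!`, hence
  -- polynomial in `n`, and nilpotency of `N` on `v` keeps only `m < D`.
  refine ⟨∑ m ∈ Finset.range D,
    Polynomial.C (ℓ ((N ^ m) v) * (z ^ m)⁻¹ * ((m.factorial : ℂ))⁻¹) * descPochhammer ℂ m, ?_⟩
  filter_upwards [eventually_ge_atTop D] with n hn
  have hcomm : Commute N (z • (1 : Module.End ℂ V)) := (Commute.one_right N).smul_right z
  have h1 : (T ^ n) v = ∑ m ∈ Finset.range (n + 1),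
      ((n.choose m : ℂ) * z ^ (n - m)) • (N ^ m) v := by
    rw [hT, hcomm.add_pow, LinearMap.sum_apply]
    refine Finset.sum_congr rfl fun m _ => ?_
    rw [smul_pow, one_pow, mul_smul_comm, mul_one, ← nsmul_eq_mul', LinearMap.smul_apply,
      LinearMap.smul_apply, ← Nat.cast_smul_eq_nsmul ℂ, smul_smul]
  have h2 : (T ^ n) v = ∑ m ∈ Finset.range D,
      ((n.choose m : ℂ) * z ^ (n - m)) • (N ^ m) v := by
    rw [h1]
    symm
    apply Finset.sum_subset
    · intro m hm
      simp only [Finset.mem_range] at hm ⊢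
      omega
    · intro m _ hm
      rw [hN0 m (by simpa using hm), smul_zero]
  rw [h2, map_sum, Polynomial.eval_finsetSum, Finset.sum_mul]
  refine Finset.sum_congr rfl fun m hm => ?_
  have hmn : m ≤ n := by
    have := Finset.mem_range.1 hm
    omega
  have hch : (n.choose m : ℂ) = (m.factorial : ℂ)⁻¹ * (n.descFactorial m : ℂ) := by
    rw [Nat.descFactorial_eq_factorial_mul_choose]
    push_cast
    rw [inv_mul_cancel_left₀]
    exact_mod_cast m.factorial_ne_zero
  rw [map_smul, smul_eq_mul, Polynomial.eval_mul, Polynomial.eval_C,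
    descPochhammer_eval_eq_descFactorial, hch, pow_sub₀ z hz hmn]
  ring

/-- The values `ℓ (T ^ n v)` are eventually given by an exponential polynomial. -/
theorem exists_expPolynomial {V : Type*} [AddCommGroup V] [Module ℂ V] [FiniteDimensional ℂ V]
    (T : Module.End ℂ V) (ℓ : V →ₗ[ℂ] ℂ) (v : V) :
    ∃ c : ℂ →₀ Polynomial ℂ, (0 : ℂ) ∉ c.support ∧ ∀ᶠ n : ℕ in atTop,
      ℓ ((T ^ n) v) = c.sum fun z p => p.eval (n : ℂ) * z ^ n := by
  have hv : v ∈ ⨆ z, T.maxGenEigenspace z := by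
    rw [Module.End.iSup_maxGenEigenspace_eq_top]
    trivial
  induction hv using Submodule.iSup_induction' with
  | mem z v hv =>
    rcases eq_or_ne z 0 with rfl | hz
    · obtain ⟨D, hD⟩ := (Module.End.mem_maxGenEigenspace T 0 v).1 hv
      refine ⟨0, by simp, ?_⟩
      filter_upwards [eventually_ge_atTop D] with n hn
      obtain ⟨e, rfl⟩ := Nat.exists_eq_add_of_le' hn
      rw [zero_smul, sub_zero] at hD
      rw [pow_add, Module.End.mul_apply, hD]
      simp
    · obtain ⟨p, hp⟩ := exists_eval_mul_pow_of_mem_maxGenEigenspace T ℓ hz hv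
      refine ⟨Finsupp.single z p, ?_, ?_⟩
      · intro h
        exact hz (Finset.mem_singleton.1 (Finsupp.support_single_subset h)).symm
      · filter_upwards [hp] with n hn
        rw [hn, Finsupp.sum_single_index]
        simp
  | zero => exact ⟨0, by simp, by simp⟩
  | add x y _ _ hx hy =>
    obtain ⟨c, hc0, hc⟩ := hx
    obtain ⟨e, he0, he⟩ := hy
    refine ⟨c + e, ?_, ?_⟩
    · simp only [Finsupp.mem_support_iff, not_not, Finsupp.add_apply] at *
      simp [hc0, he0]
    · filter_upwards [hc, he] with n hcn hen
      rw [map_add, map_add, hcn, hen, Finsupp.sum_add_index']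
      · simp
      · intros
        rw [Polynomial.eval_add, add_mul]

/-! ### Growth of exponential polynomials -/

/-- The scale `n ^ k * ρ ^ n`. -/
noncomputable def powExp (ρ : ℝ) (k : ℕ) (n : ℕ) : ℝ := (n : ℝ) ^ k * ρ ^ n

theorem powExp_pos {ρ : ℝ} (hρ : 0 < ρ) (k : ℕ) {n : ℕ} (hn : 0 < n) : 0 < powExp ρ k n := by
  unfold powExp
  positivity

theorem tendsto_eval_div_pow (p : Polynomial ℂ) (k : ℕ) (hp : p.natDegree ≤ k) :
    Tendsto (fun n : ℕ => p.eval (n : ℂ) / (n : ℂ) ^ k) atTop (nhds (p.coeff k)) := by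
  have h : ∀ i ∈ Finset.range (k + 1), Tendsto (fun n : ℕ => p.coeff i * ((n : ℂ)⁻¹) ^ (k - i))
      atTop (nhds (if i = k then p.coeff k else 0)) := by
    intro i hi
    have hi' : i ≤ k := by simpa [Nat.lt_succ_iff] using hi
    split_ifs with hik
    · subst hik
      simp
    · have h0 : Tendsto (fun n : ℕ => ((n : ℂ)⁻¹) ^ (k - i)) atTop (nhds (0 ^ (k - i))) :=
        (tendsto_inv_atTop_nhds_zero_nat (𝕜 := ℂ)).pow _
      rw [zero_pow (by omega)] at h0
      simpa using h0.const_mul (p.coeff i)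
  have h2 := tendsto_finsetSum _ h
  rw [Finset.sum_ite_eq' , if_pos (by simp)] at h2
  refine h2.congr' ?_
  filter_upwards [eventually_gt_atTop 0] with n hn
  have hn' : (n : ℂ) ≠ 0 := by exact_mod_cast hn.ne'
  rw [Polynomial.eval_eq_sum_range' (Nat.lt_succ_of_le hp), Finset.sum_div]
  refine Finset.sum_congr rfl fun i hi => ?_
  have hi' : i ≤ k := by simpa [Nat.lt_succ_iff] using hi
  rw [inv_pow, mul_div_assoc]
  congr 1
  rw [eq_div_iff (pow_ne_zero _ hn'), ← Nat.sub_add_cancel hi', pow_add, Nat.sub_add_cancel hi',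
    inv_mul_cancel_left₀ (pow_ne_zero _ hn')]

/-- A polynomial times a geometric sequence of ratio of modulus less than one tends to zero. -/
theorem tendsto_eval_mul_pow_zero (p : Polynomial ℂ) {w : ℂ} (hw : ‖w‖ < 1) :
    Tendsto (fun n : ℕ => p.eval (n : ℂ) * w ^ n) atTop (nhds 0) := by
  have h : ∀ i ∈ Finset.range (p.natDegree + 1),
      Tendsto (fun n : ℕ => p.coeff i * ((n : ℂ) ^ i * w ^ n)) atTop (nhds 0) := by
    intro i _
    have h0 : Tendsto (fun n : ℕ => (n : ℂ) ^ i * w ^ n) atTop (nhds 0) := by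
      rw [tendsto_zero_iff_norm_tendsto_zero]
      simpa using tendsto_pow_const_mul_const_pow_of_lt_one i (norm_nonneg w) hw
    simpa using h0.const_mul (p.coeff i)
  have h2 := tendsto_finsetSum _ h
  rw [Finset.sum_const_zero] at h2
  refine h2.congr fun n => ?_
  rw [Polynomial.eval_eq_sum_range, Finset.sum_mul]
  refine Finset.sum_congr rfl fun i _ => ?_
  ring

/-- An exponential sum that involves a base on the unit circle has a definite size somewhere in every
window of fixed length. -/
theorem exists_window_lower_bound (S : Finset ℂ) (a : ℂ → ℂ) {z₀ : ℂ} (hz₀ : z₀ ∈ S)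
    (ha : a z₀ ≠ 0) (hn : ‖z₀‖ = 1) :
    ∃ d : ℕ, ∃ c : ℝ, 0 < c ∧ ∀ n : ℕ, ∃ m, n ≤ m ∧ m < n + d ∧
      c ≤ ‖∑ z ∈ S, a z * z ^ m‖ := by
  -- `Q`, read as a polynomial in the shift operator, annihilates every base except `z₀`. A fixed
  -- combination of `d` consecutive values then has constant nonzero modulus, so these values cannot
  -- all be small.
  set Q : Polynomial ℂ := ∏ z ∈ S.erase z₀, (Polynomial.X - Polynomial.C z) with hQ
  have hQz : ∀ z ∈ S, z ≠ z₀ → Q.eval z = 0 := by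
    intro z hz hne
    rw [hQ, Polynomial.eval_prod]
    exact Finset.prod_eq_zero (Finset.mem_erase.2 ⟨hne, hz⟩) (by simp)
  have hQ0 : Q.eval z₀ ≠ 0 := by
    rw [hQ, Polynomial.eval_prod]
    refine Finset.prod_ne_zero_iff.2 fun z hz => ?_
    simpa [sub_eq_zero] using (Finset.ne_of_mem_erase hz).symm
  set d := Q.natDegree + 1 with hd
  set W : ℝ := ∑ i ∈ Finset.range d, ‖Q.coeff i‖ with hW
  have hkey : ∀ n : ℕ, ∑ i ∈ Finset.range d, Q.coeff i * ∑ z ∈ S, a z * z ^ (n + i) =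
      a z₀ * z₀ ^ n * Q.eval z₀ := by
    intro n
    have : ∀ i ∈ Finset.range d, Q.coeff i * ∑ z ∈ S, a z * z ^ (n + i) =
        ∑ z ∈ S, a z * z ^ n * (Q.coeff i * z ^ i) := by
      intro i _
      rw [Finset.mul_sum]
      refine Finset.sum_congr rfl fun z _ => ?_
      ring
    rw [Finset.sum_congr rfl this, Finset.sum_comm]
    simp_rw [← Finset.mul_sum, hd, ← Polynomial.eval_eq_sum_range]
    rw [Finset.sum_eq_single z₀]
    · intro z hz hne
      rw [hQz z hz hne, mul_zero]
    · exact fun h => absurd hz₀ h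
  have hpos : 0 < ‖a z₀‖ * ‖Q.eval z₀‖ := by positivity
  have hW0 : 0 ≤ W := Finset.sum_nonneg fun i _ => norm_nonneg _
  refine ⟨d, ‖a z₀‖ * ‖Q.eval z₀‖ / (W + 1), by positivity, fun n => ?_⟩
  by_contra! hcon
  have h1 : ‖a z₀‖ * ‖Q.eval z₀‖ ≤ W * (‖a z₀‖ * ‖Q.eval z₀‖ / (W + 1)) := by
    calc ‖a z₀‖ * ‖Q.eval z₀‖ = ‖a z₀ * z₀ ^ n * Q.eval z₀‖ := by simp [hn]
      _ ≤ ∑ i ∈ Finset.range d, ‖Q.coeff i * ∑ z ∈ S, a z * z ^ (n + i)‖ := by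
        rw [← hkey]
        exact norm_sum_le _ _
      _ ≤ ∑ i ∈ Finset.range d, ‖Q.coeff i‖ * (‖a z₀‖ * ‖Q.eval z₀‖ / (W + 1)) := by
        refine Finset.sum_le_sum fun i hi => ?_
        rw [norm_mul]
        have := Finset.mem_range.1 hi
        gcongr
        exact (hcon (n + i) (by omega) (by omega)).le
      _ = _ := by rw [hW, Finset.sum_mul]
  rw [mul_div_assoc', le_div_iff₀ (by positivity)] at h1
  nlinarith

/-- A sequence `ℓ (T ^ n v)` in a finite-dimensional space is eventually zero or has the growth of
`n ^ k * ρ ^ n`, attained up to a constant in every window of fixed length. -/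
theorem eventually_zero_or_growth {V : Type*} [AddCommGroup V] [Module ℂ V]
    [FiniteDimensional ℂ V] (T : Module.End ℂ V) (ℓ : V →ₗ[ℂ] ℂ) (v : V) :
    (∀ᶠ n : ℕ in atTop, ℓ ((T ^ n) v) = 0) ∨
    ∃ ρ : ℝ, 0 < ρ ∧ ∃ k : ℕ, ((fun n : ℕ => ℓ ((T ^ n) v)) =O[atTop] powExp ρ k) ∧
      ∃ d : ℕ, ∃ c : ℝ, 0 < c ∧ ∀ᶠ n : ℕ in atTop, ∃ m, n ≤ m ∧ m < n + d ∧
        c * powExp ρ k m ≤ ‖ℓ ((T ^ m) v)‖ := by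
  obtain ⟨e, he0, he⟩ := exists_expPolynomial T ℓ v
  set f : ℕ → ℂ := fun n => ℓ ((T ^ n) v) with hf
  rcases e.support.eq_empty_or_nonempty with hemp | hne
  · left
    rw [Finsupp.support_eq_empty] at hemp
    subst hemp
    simpa using he
  right
  obtain ⟨z₁, hz₁, hmax⟩ := e.support.exists_max_image (fun z => ‖z‖) hne
  set ρ : ℝ := ‖z₁‖ with hρ
  have hρ0 : 0 < ρ := by
    rw [hρ, norm_pos_iff]
    rintro rfl
    exact he0 hz₁
  have hρC : (ρ : ℂ) ≠ 0 := by exact_mod_cast hρ0.ne'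
  -- Among the bases of maximal modulus, one of maximal polynomial degree fixes the exponent `k`.
  -- After division by the scale, only the `n ^ k` coefficients at dominant bases survive; they form
  -- `g`.
  obtain ⟨z₀, hz₀, hdeg⟩ := (e.support.filter fun z => ‖z‖ = ρ).exists_max_image
    (fun z => (e z).natDegree) ⟨z₁, by simp only [Finset.mem_filter]; exact ⟨hz₁, rfl⟩⟩
  set k := (e z₀).natDegree with hk
  obtain ⟨hz₀S, hz₀ρ⟩ := Finset.mem_filter.1 hz₀
  set a : ℂ → ℂ := fun z => if ‖z‖ = ρ then (e z).coeff k else 0 with ha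
  set g : ℕ → ℂ := fun n => ∑ z ∈ e.support, a z * (z / ρ) ^ n with hg
  have hnorm : ∀ z ∈ e.support, ‖z / (ρ : ℂ)‖ ≤ 1 := by
    intro z hz
    rw [norm_div, Complex.norm_real, Real.norm_of_nonneg hρ0.le]
    exact (div_le_one hρ0).2 (hmax z hz)
  have hterm : ∀ z ∈ e.support, Tendsto (fun n : ℕ =>
      (e z).eval (n : ℂ) * z ^ n / (powExp ρ k n : ℝ) - a z * (z / ρ) ^ n) atTop (nhds 0) := by
    intro z hz
    have hform : ∀ n : ℕ, (e z).eval (n : ℂ) * z ^ n / (powExp ρ k n : ℝ) =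
        (e z).eval (n : ℂ) / (n : ℂ) ^ k * (z / ρ) ^ n := by
      intro n
      simp only [powExp]
      push_cast
      rw [div_pow, mul_div_mul_comm]
    by_cases hzρ : ‖z‖ = ρ
    · have h1 := (tendsto_eval_div_pow (e z) k
        (hdeg z (Finset.mem_filter.2 ⟨hz, hzρ⟩))).sub_const ((e z).coeff k)
      rw [sub_self] at h1
      refine squeeze_zero_norm (fun n => ?_) (tendsto_zero_iff_norm_tendsto_zero.1 h1)
      rw [hform, ha]
      simp only [hzρ, if_true]
      rw [← sub_mul, norm_mul, norm_pow]
      exact mul_le_of_le_one_right (norm_nonneg _) (pow_le_one₀ (norm_nonneg _) (hnorm z hz))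
    · have hlt : ‖z / (ρ : ℂ)‖ < 1 := by
        rw [norm_div, Complex.norm_real, Real.norm_of_nonneg hρ0.le]
        exact (div_lt_one hρ0).2 (lt_of_le_of_ne (hmax z hz) hzρ)
      refine squeeze_zero_norm' ?_
        (tendsto_zero_iff_norm_tendsto_zero.1 (tendsto_eval_mul_pow_zero (e z) hlt))
      filter_upwards [eventually_ge_atTop 1] with n hn
      rw [hform, ha]
      simp only [hzρ, if_false, zero_mul, sub_zero]
      rw [norm_mul, norm_mul, norm_div]
      refine mul_le_mul_of_nonneg_right (div_le_self (norm_nonneg _) ?_) (norm_nonneg _)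
      rw [norm_pow, Complex.norm_natCast]
      exact one_le_pow₀ (by exact_mod_cast hn)
  have hdiff : Tendsto (fun n => f n / (powExp ρ k n : ℝ) - g n) atTop (nhds 0) := by
    have h2 := tendsto_finsetSum _ hterm
    rw [Finset.sum_const_zero] at h2
    refine h2.congr' ?_
    filter_upwards [he] with n hn
    rw [hf, hg]
    simp only
    rw [hn, Finsupp.sum, Finset.sum_div, Finset.sum_sub_distrib]
  have hgbd : ∀ n, ‖g n‖ ≤ ∑ z ∈ e.support, ‖a z‖ := by
    intro n
    refine (norm_sum_le _ _).trans (Finset.sum_le_sum fun z hz => ?_)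
    rw [norm_mul, norm_pow]
    exact mul_le_of_le_one_right (norm_nonneg _) (pow_le_one₀ (norm_nonneg _) (hnorm z hz))
  have hnormdiv : ∀ n, 0 < n → ‖f n / (powExp ρ k n : ℝ)‖ * powExp ρ k n = ‖f n‖ := by
    intro n hn
    have := powExp_pos hρ0 k hn
    rw [norm_div, Complex.norm_real, Real.norm_of_nonneg this.le, div_mul_cancel₀ _ this.ne']
  refine ⟨ρ, hρ0, k, ?_, ?_⟩
  · refine IsBigO.of_bound ((∑ z ∈ e.support, ‖a z‖) + 1) ?_
    filter_upwards [(tendsto_zero_iff_norm_tendsto_zero.1 hdiff).eventually_le_const one_pos,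
      eventually_gt_atTop 0] with n hn hn0
    have hp := powExp_pos hρ0 k hn0
    rw [Real.norm_of_nonneg hp.le, ← hnormdiv n hn0]
    refine mul_le_mul_of_nonneg_right ?_ hp.le
    calc ‖f n / (powExp ρ k n : ℝ)‖ = ‖g n + (f n / (powExp ρ k n : ℝ) - g n)‖ := by
          congr 1
          ring
      _ ≤ _ := (norm_add_le _ _).trans (add_le_add (hgbd n) hn)
  · have hinj : Function.Injective fun z : ℂ => z / (ρ : ℂ) := fun x y hxy =>
      (div_left_inj' hρC).1 hxy
    obtain ⟨d, c, hc, hwin⟩ := exists_window_lower_bound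
      (e.support.map ⟨fun z => z / (ρ : ℂ), hinj⟩) (fun z => a (z * ρ))
      (z₀ := z₀ / ρ) (Finset.mem_map.2 ⟨z₀, hz₀S, rfl⟩)
      (by
        simp only [div_mul_cancel₀ _ hρC]
        rw [ha]
        simp only [hz₀ρ, if_true]
        rw [hk, Polynomial.coeff_natDegree, Polynomial.leadingCoeff_ne_zero]
        exact Finsupp.mem_support_iff.1 hz₀S)
      (by rw [norm_div, Complex.norm_real, Real.norm_of_nonneg hρ0.le, hz₀ρ, div_self hρ0.ne'])
    -- The other half of `c` absorbs the error between the normalized sequence and `g`.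
    refine ⟨d, c / 2, by positivity, ?_⟩
    obtain ⟨n₀, hn₀⟩ := eventually_atTop.1
      ((tendsto_zero_iff_norm_tendsto_zero.1 hdiff).eventually_le_const (half_pos hc))
    filter_upwards [eventually_ge_atTop n₀, eventually_gt_atTop 0] with n hn hn0
    obtain ⟨m, hnm, hmd, hcm⟩ := hwin n
    refine ⟨m, hnm, hmd, ?_⟩
    have hm0 : 0 < m := by omega
    have hgm : c ≤ ‖g m‖ := by
      refine hcm.trans_eq ?_
      rw [Finset.sum_map, hg]
      simp [div_mul_cancel₀ _ hρC]
    change _ ≤ ‖f m‖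
    rw [← hnormdiv m hm0]
    refine mul_le_mul_of_nonneg_right ?_ (powExp_pos hρ0 k hm0).le
    have h3 := hn₀ m (hn.trans hnm)
    have h4 := norm_sub_norm_le (g m) (f m / (powExp ρ k m : ℝ))
    rw [norm_sub_rev] at h4
    linarith

/-! ### Scales with logarithms and their comparison -/

/-- The scale `r ^ n * n ^ a * (log n) ^ b`. -/
noncomputable def logScale (r a b : ℝ) (n : ℕ) : ℝ :=
  r ^ n * (n : ℝ) ^ a * Real.log n ^ b

theorem logScale_pos {r : ℝ} (hr : 0 < r) (a b : ℝ) {n : ℕ} (hn : 2 ≤ n) :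
    0 < logScale r a b n := by
  have h1 : (1 : ℝ) < n := by exact_mod_cast hn
  have h2 := Real.log_pos h1
  unfold logScale
  positivity

theorem powExp_eq_logScale (ρ : ℝ) (k : ℕ) : powExp ρ k = logScale ρ k 0 := by
  funext n
  simp [powExp, logScale, mul_comm]

theorem logScale_mul {r r' : ℝ} (a a' b b' : ℝ) {n : ℕ} (hn : 2 ≤ n) :
    logScale r a b n * logScale r' a' b' n = logScale (r * r') (a + a') (b + b') n := by
  have h1 : (1 : ℝ) < n := by exact_mod_cast hn
  have h2 := Real.log_pos h1
  unfold logScale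
  rw [Real.rpow_add (by linarith), Real.rpow_add h2, mul_pow]
  ring

theorem tendsto_natCast_real_atTop : Tendsto (fun n : ℕ => (n : ℝ)) atTop atTop :=
  tendsto_natCast_atTop_atTop

theorem tendsto_logScale_one_neg {a : ℝ} (ha : a < 0) (b : ℝ) :
    Tendsto (logScale 1 a b) atTop (nhds 0) := by
  have h := (isLittleO_log_rpow_rpow_atTop b (neg_pos.2 ha)).tendsto_div_nhds_zero.comp
    tendsto_natCast_real_atTop
  refine h.congr fun n => ?_
  simp only [Function.comp, logScale, one_pow, one_mul]
  rw [Real.rpow_neg (Nat.cast_nonneg n), div_inv_eq_mul, mul_comm]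

theorem tendsto_logScale_of_lt_one {r : ℝ} (hr0 : 0 < r) (hr : r < 1) (a b : ℝ) :
    Tendsto (logScale r a b) atTop (nhds 0) := by
  -- One power of `n` is borrowed from the exponential decay to dominate the logarithmic factor.
  have h1 : Tendsto (logScale r (a + 1) 0) atTop (nhds 0) := by
    have h := (tendsto_rpow_mul_exp_neg_mul_atTop_nhds_zero (a + 1) (-Real.log r)
      (neg_pos.2 (Real.log_neg hr0 hr))).comp tendsto_natCast_real_atTop
    refine h.congr fun n => ?_
    simp only [Function.comp, logScale, Real.rpow_zero, mul_one, neg_neg]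
    rw [mul_comm, mul_comm (Real.log r), Real.exp_nat_mul, Real.exp_log hr0]
  have h := h1.mul (tendsto_logScale_one_neg (a := -1) (by norm_num) b)
  rw [mul_zero] at h
  refine h.congr' ?_
  filter_upwards [eventually_ge_atTop 2] with n hn
  rw [logScale_mul _ _ _ _ hn]
  simp

theorem tendsto_logScale_one_zero_neg {b : ℝ} (hb : b < 0) :
    Tendsto (logScale 1 0 b) atTop (nhds 0) := by
  have h := (tendsto_rpow_neg_atTop (neg_pos.2 hb)).comp
    (Real.tendsto_log_atTop.comp tendsto_natCast_real_atTop)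
  refine h.congr fun n => ?_
  simp [Function.comp, logScale]

/-- The scales are ordered lexicographically. -/
theorem logScale_isLittleO {r r' a a' b b' : ℝ} (hr : 0 < r) (hr' : 0 < r')
    (h : r < r' ∨ r = r' ∧ (a < a' ∨ a = a' ∧ b < b')) :
    logScale r a b =o[atTop] logScale r' a' b' := by
  have hlim : Tendsto (logScale (r * r'⁻¹) (a + -a') (b + -b')) atTop (nhds 0) := by
    rcases h with h | ⟨rfl, h | ⟨rfl, h⟩⟩
    · refine tendsto_logScale_of_lt_one (by positivity) ?_ _ _
      rw [← div_eq_mul_inv]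
      exact (div_lt_one hr').2 h
    · rw [mul_inv_cancel₀ hr.ne']
      exact tendsto_logScale_one_neg (by linarith) _
    · rw [mul_inv_cancel₀ hr.ne', add_neg_cancel]
      exact tendsto_logScale_one_zero_neg (by linarith)
  refine (isLittleO_iff_tendsto' ?_).2 (hlim.congr' ?_)
  · filter_upwards [eventually_ge_atTop 2] with n hn h0
    exact absurd h0 (logScale_pos hr' _ _ hn).ne'
  · filter_upwards [eventually_ge_atTop 2] with n hn
    rw [eq_div_iff (logScale_pos hr' _ _ hn).ne', logScale_mul _ _ _ _ hn]
    simp [hr'.ne']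

/-- A sequence of order `logScale r a b` cannot be frequently comparable from below with, and
bounded by, a different scale. -/
theorem logScale_unique {f : ℕ → ℝ} {r r' a a' b b' : ℝ} (hr : 0 < r) (hr' : 0 < r')
    (hf : f =Θ[atTop] logScale r a b) (hO : f =O[atTop] logScale r' a' b')
    {c : ℝ} (hc : 0 < c) (hfreq : ∃ᶠ n in atTop, c * logScale r' a' b' n ≤ ‖f n‖) :
    r = r' ∧ a = a' ∧ b = b' := by
  have hA : ¬ (r' < r ∨ r' = r ∧ (a' < a ∨ a' = a ∧ b' < b)) := by
    intro h
    have h1 : logScale r a b =o[atTop] logScale r a b :=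
      (hf.2.trans hO).trans_isLittleO (logScale_isLittleO hr' hr h)
    have h2 := h1.bound (show (0 : ℝ) < 1 / 2 by norm_num)
    obtain ⟨n, hn, hn2⟩ := (h2.and (eventually_ge_atTop 2)).exists
    have h3 := norm_pos_iff.2 (logScale_pos hr a b hn2).ne'
    linarith
  have hB : ¬ (r < r' ∨ r = r' ∧ (a < a' ∨ a = a' ∧ b < b')) := by
    intro h
    have h1 : f =o[atTop] logScale r' a' b' :=
      hf.1.trans_isLittleO (logScale_isLittleO hr hr' h)
    have h2 := h1.bound (half_pos hc)
    obtain ⟨n, hn1, hn, hn2⟩ := (hfreq.and_eventually (h2.and (eventually_ge_atTop 2))).exists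
    have h3 := logScale_pos hr' a' b' hn2
    rw [Real.norm_of_nonneg h3.le] at hn
    nlinarith
  grind

/-- Constant factors in `u` become a bounded additive error in `log u`, negligible against `g` since
`g` tends to infinity. -/
theorem isTheta_log_of_isTheta {u : ℕ → ℝ} {r : ℝ} {k : ℕ} (hr : 0 < r)
    (hu : u =Θ[atTop] powExp r k) (hu0 : ∀ᶠ n in atTop, 0 < u n) {g : ℕ → ℝ}
    (hg : Tendsto g atTop atTop)
    (hlog : (fun n : ℕ => (k : ℝ) * Real.log n + n * Real.log r) =Θ[atTop] g) :
    (fun n => Real.log (u n)) =Θ[atTop] g := by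
  obtain ⟨c₁, hc₁, h₁⟩ := hu.1.exists_pos
  obtain ⟨c₂, hc₂, h₂⟩ := hu.2.exists_pos
  have hbd : (fun n : ℕ => Real.log (u n) - ((k : ℝ) * Real.log n + n * Real.log r))
      =O[atTop] (fun _ => (1 : ℝ)) := by
    refine IsBigO.of_bound (|Real.log c₁| + |Real.log c₂|) ?_
    filter_upwards [h₁.bound, h₂.bound, hu0, eventually_gt_atTop 0] with n hn₁ hn₂ hn hn0
    have hp := powExp_pos hr k hn0
    have hn' : (0 : ℝ) < n := by exact_mod_cast hn0
    have hlp : Real.log (powExp r k n) = (k : ℝ) * Real.log n + n * Real.log r := by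
      rw [powExp, Real.log_mul (by positivity) (by positivity), Real.log_pow, Real.log_pow]
    rw [Real.norm_of_nonneg hn.le, Real.norm_of_nonneg hp.le] at hn₁ hn₂
    have l₁ := Real.log_le_log hn hn₁
    have l₂ := Real.log_le_log hp hn₂
    rw [Real.log_mul hc₁.ne' hp.ne'] at l₁
    rw [Real.log_mul hc₂.ne' hn.ne'] at l₂
    rw [← hlp, norm_one, mul_one, Real.norm_eq_abs, abs_le]
    have := neg_abs_le (Real.log c₁)
    have := le_abs_self (Real.log c₁)
    have := le_abs_self (Real.log c₂)
    have := abs_nonneg (Real.log c₁)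
    have := abs_nonneg (Real.log c₂)
    constructor <;> linarith
  have hone : (fun _ : ℕ => (1 : ℝ)) =o[atTop] g :=
    (isLittleO_const_left.2 (Or.inr (tendsto_norm_atTop_atTop.comp hg)))
  have := hlog.add_isLittleO (hbd.trans_isLittleO hone)
  have h3 : (fun n => Real.log (u n)) =
      (fun n : ℕ => (k : ℝ) * Real.log n + n * Real.log r) +
      fun n : ℕ => Real.log (u n) - ((k : ℝ) * Real.log n + n * Real.log r) := by
    funext n
    simp
  rw [h3]
  exact this

/-- Monotonicity carries the lower bound at some point of each window to the window's end, and a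
shift by `d` changes the scale only by a bounded factor. -/
theorem isTheta_powExp_of_monotone {f : ℕ → ℝ} (hmono : Monotone f) (hone : ∀ n, 1 ≤ f n)
    {ρ : ℝ} (hρ : 0 < ρ) {k : ℕ} (hO : f =O[atTop] powExp ρ k) {d : ℕ} {c : ℝ} (hc : 0 < c)
    (hwin : ∀ᶠ n : ℕ in atTop, ∃ m, n ≤ m ∧ m < n + d ∧ c * powExp ρ k m ≤ f m) :
    1 ≤ ρ ∧ f =Θ[atTop] powExp ρ k := by
  have hρ1 : 1 ≤ ρ := by
    by_contra! hlt
    rw [powExp_eq_logScale] at hO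
    have h0 := hO.trans_tendsto (tendsto_logScale_of_lt_one hρ hlt k 0)
    obtain ⟨n, hn⟩ := (h0.eventually_lt_const one_pos).exists
    exact absurd (hone n) (not_le.2 hn)
  refine ⟨hρ1, hO, ?_⟩
  have hshift : ∀ᶠ n in atTop, c * powExp ρ k n ≤ f (n + d) := by
    filter_upwards [hwin] with n hn
    obtain ⟨m, hnm, hmd, hm⟩ := hn
    refine le_trans ?_ (hm.trans (hmono hmd.le))
    unfold powExp
    gcongr
  refine IsBigO.of_bound (2 ^ k * ρ ^ d / c) ?_
  -- With `n = m + d`, this threshold gives `m + d ≤ 2 * m`, the source of the factor `2 ^ k`.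
  filter_upwards [(tendsto_sub_atTop_nat d).eventually hshift, eventually_ge_atTop (2 * d + 1)]
    with n hn hnd
  obtain ⟨m, rfl⟩ : ∃ m, n = m + d := ⟨n - d, by omega⟩
  rw [Nat.add_sub_cancel] at hn
  rw [Real.norm_of_nonneg (powExp_pos hρ k (by omega)).le,
    Real.norm_of_nonneg (zero_le_one.trans (hone _)), div_mul_eq_mul_div, le_div_iff₀ hc]
  have h2 : powExp ρ k (m + d) ≤ 2 ^ k * ρ ^ d * powExp ρ k m := by
    have h3 : ((m + d : ℕ) : ℝ) ≤ 2 * m := by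
      exact_mod_cast (by omega : m + d ≤ 2 * m)
    calc powExp ρ k (m + d) = ((m + d : ℕ) : ℝ) ^ k * (ρ ^ m * ρ ^ d) := by rw [powExp, pow_add]
      _ ≤ (2 * m : ℝ) ^ k * (ρ ^ m * ρ ^ d) := by gcongr
      _ = _ := by
        rw [powExp, mul_pow]
        ring
  have h4 : 0 ≤ 2 ^ k * ρ ^ d := by positivity
  nlinarith

/-! ### Letter counts as linear algebra -/

section Parikh

variable {B : Type*} [Fintype B] [DecidableEq B]

/-- The vector of numbers of occurrences of the letters in a word. -/
def parikhVector (u : FreeMonoid B) : B → ℂ := fun x => (letterCount x u : ℂ)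

/-- An additive function on words is determined by its values on letters, so it factors linearly
through the vector of letter counts. -/
theorem linearCombination_parikhVector {E : Type*} [AddCommGroup E] [Module ℂ E]
    (F : FreeMonoid B → E) (h1 : F 1 = 0) (hmul : ∀ u v, F (u * v) = F u + F v)
    (u : FreeMonoid B) :
    Fintype.linearCombination ℂ (fun x => F (FreeMonoid.of x)) (parikhVector u) = F u := by
  induction u using FreeMonoid.inductionOn' with
  | one =>
    have : parikhVector (1 : FreeMonoid B) = 0 := by
      funext x
      simp [parikhVector, letterCount]
    rw [this, map_zero, h1]
  | of_mul x u ih =>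
    have : parikhVector (FreeMonoid.of x * u) = Pi.single x 1 + parikhVector u := by
      funext y
      simp only [parikhVector, letterCount, FreeMonoid.toList_of_mul, List.count_cons,
        Pi.add_apply, Pi.single_apply, beq_iff_eq, eq_comm (a := x)]
      split_ifs <;> simp [add_comm]
    rw [this, map_add, ih, hmul, Fintype.linearCombination_apply_single, one_smul]

/-- The incidence operator of a morphism, acting on vectors of numbers of occurrences. -/
noncomputable def incidenceOperator (φ : FreeMonoid B →* FreeMonoid B) : Module.End ℂ (B → ℂ) :=
  Fintype.linearCombination ℂ fun x => parikhVector (φ (FreeMonoid.of x))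

theorem incidenceOperator_pow_parikhVector (φ : FreeMonoid B →* FreeMonoid B) (n : ℕ)
    (u : FreeMonoid B) :
    (incidenceOperator φ ^ n) (parikhVector u) = parikhVector ((⇑φ)^[n] u) := by
  have hstep : ∀ u, incidenceOperator φ (parikhVector u) = parikhVector (φ u) := fun u =>
    linearCombination_parikhVector (fun u => parikhVector (φ u))
      (by funext x; simp [parikhVector, letterCount])
      (fun u v => by funext x; simp [parikhVector, letterCount]) u
  induction n with
  | zero => simp
  | succ n ih => rw [pow_succ', Module.End.mul_apply, ih, hstep, Function.iterate_succ_apply']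

end Parikh

/-- The values of an additive function along the iterates of a morphism eventually vanish or grow
like `n ^ k * ρ ^ n`. -/
theorem iterate_eventually_zero_or_growth {B : Type*} [Finite B]
    (φ : FreeMonoid B →* FreeMonoid B) (b : B)
    (F : FreeMonoid B → ℕ) (h1 : F 1 = 0) (hmul : ∀ u v, F (u * v) = F u + F v) :
    (∀ᶠ n in atTop, F ((⇑φ)^[n] (FreeMonoid.of b)) = 0) ∨
    ∃ ρ : ℝ, 0 < ρ ∧ ∃ k : ℕ,
      ((fun n => (F ((⇑φ)^[n] (FreeMonoid.of b)) : ℝ)) =O[atTop] powExp ρ k) ∧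
      ∃ d : ℕ, ∃ c : ℝ, 0 < c ∧ ∀ᶠ n : ℕ in atTop, ∃ m, n ≤ m ∧ m < n + d ∧
        c * powExp ρ k m ≤ F ((⇑φ)^[m] (FreeMonoid.of b)) := by
  classical
  cases nonempty_fintype B
  set ℓ : (B → ℂ) →ₗ[ℂ] ℂ :=
    Fintype.linearCombination ℂ fun x => (F (FreeMonoid.of x) : ℂ) with hℓ
  have hval : ∀ n, ℓ ((incidenceOperator φ ^ n) (parikhVector (FreeMonoid.of b))) =
      (F ((⇑φ)^[n] (FreeMonoid.of b)) : ℂ) := by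
    intro n
    rw [incidenceOperator_pow_parikhVector]
    exact linearCombination_parikhVector (fun u => (F u : ℂ)) (by simp [h1])
      (fun u v => by simp [hmul]) _
  have hmain := eventually_zero_or_growth (incidenceOperator φ) ℓ
    (parikhVector (FreeMonoid.of b))
  simp only [hval, Nat.cast_eq_zero, Complex.norm_natCast] at hmain
  rcases hmain with h | ⟨ρ, hρ, k, hO, hwin⟩
  · exact Or.inl h
  · refine Or.inr ⟨ρ, hρ, k, ?_, hwin⟩
    rw [← isBigO_norm_left] at hO ⊢
    simpa using hO

/-! ### Iterates as prefixes of the limit sequence -/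

theorem length_map_of_isCoding {A B : Type*} {ψ : FreeMonoid B →* FreeMonoid A}
    (hψ : IsCoding ψ) (u : FreeMonoid B) : (ψ u).length = u.length := by
  induction u using FreeMonoid.inductionOn' with
  | one => simp
  | of_mul x u ih => rw [map_mul, FreeMonoid.length_mul, FreeMonoid.length_mul, ih, hψ x,
      FreeMonoid.length_of]

theorem exists_iterate_eq_mul {B : Type*} {φ : FreeMonoid B →* FreeMonoid B} {b : B}
    {w : FreeMonoid B} (hb : φ (FreeMonoid.of b) = FreeMonoid.of b * w) {i j : ℕ} (hij : i ≤ j) :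
    ∃ v, (⇑φ)^[j] (FreeMonoid.of b) = (⇑φ)^[i] (FreeMonoid.of b) * v := by
  induction j, hij using Nat.le_induction with
  | base => exact ⟨1, by simp⟩
  | succ j _ ih =>
    obtain ⟨v, hv⟩ := ih
    exact ⟨v * (⇑φ)^[j] w, by
      rw [Function.iterate_succ_apply, hb, iterate_map_mul, hv, mul_assoc]⟩

/-- If `ψ (φ^i b)` converges to `s`, then each of these words is a prefix of `s`. -/
theorem toList_eq_map_range_of_wordsTendsto {A B : Type*} {φ : FreeMonoid B →* FreeMonoid B}
    {ψ : FreeMonoid B →* FreeMonoid A} {b : B} {w : FreeMonoid B} {s : ℕ → A} (hψ : IsCoding ψ)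
    (hb : φ (FreeMonoid.of b) = FreeMonoid.of b * w)
    (hs : WordsTendsto (fun i => ψ ((⇑φ)^[i] (FreeMonoid.of b))) s) (i : ℕ) :
    FreeMonoid.toList (ψ ((⇑φ)^[i] (FreeMonoid.of b))) =
      (List.range ((⇑φ)^[i] (FreeMonoid.of b)).length).map s := by
  have hlen : (FreeMonoid.toList (ψ ((⇑φ)^[i] (FreeMonoid.of b)))).length =
      ((⇑φ)^[i] (FreeMonoid.of b)).length := length_map_of_isCoding hψ _
  refine List.ext_getElem? fun m => ?_
  rcases lt_or_ge m ((⇑φ)^[i] (FreeMonoid.of b)).length with hm | hm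
  -- A later iterate already shows the limit letter at `m` and extends the `i`-th iterate.
  · obtain ⟨j, hj, hij⟩ := ((hs m).and (eventually_ge_atTop i)).exists
    obtain ⟨v, hv⟩ := exists_iterate_eq_mul hb hij
    simp only [hv] at hj
    rw [map_mul, FreeMonoid.toList_mul, List.getElem?_append_left (hlen ▸ hm)] at hj
    rw [hj]
    simp [hm]
  · rw [List.getElem?_eq_none (hlen ▸ hm), List.getElem?_eq_none (by simpa using hm)]

theorem monotone_length_iterate {B : Type*} {φ : FreeMonoid B →* FreeMonoid B} {b : B}
    {w : FreeMonoid B} (hb : φ (FreeMonoid.of b) = FreeMonoid.of b * w) :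
    Monotone fun n => ((⇑φ)^[n] (FreeMonoid.of b)).length := by
  intro i j hij
  obtain ⟨v, hv⟩ := exists_iterate_eq_mul hb hij
  simp [hv]

theorem tendsto_length_iterate {A B : Type*} {φ : FreeMonoid B →* FreeMonoid B}
    {ψ : FreeMonoid B →* FreeMonoid A} {b : B} {w : FreeMonoid B} {s : ℕ → A} (hψ : IsCoding ψ)
    (hb : φ (FreeMonoid.of b) = FreeMonoid.of b * w)
    (hs : WordsTendsto (fun i => ψ ((⇑φ)^[i] (FreeMonoid.of b))) s) :
    Tendsto (fun n => ((⇑φ)^[n] (FreeMonoid.of b)).length) atTop atTop := by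
  refine tendsto_atTop_atTop_of_monotone (monotone_length_iterate hb) fun m => ?_
  obtain ⟨i, hi⟩ := (hs m).exists
  refine ⟨i, ?_⟩
  rw [← length_map_of_isCoding hψ]
  obtain ⟨h, -⟩ := List.getElem?_eq_some_iff.1 hi
  exact h.le

/-! ### The contradiction -/

/-- If `u` has order `n ^ k * r ^ n` and tends to infinity, then `u / (log u) ^ γ` has the order of
`logScale r (k - γ) 0` or of `logScale 1 k (-γ)`. -/
theorem isTheta_div_log_rpow {u : ℕ → ℝ} (hu : Tendsto u atTop atTop) {r : ℝ} (hr : 1 ≤ r)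
    {k : ℕ} (hΘ : u =Θ[atTop] powExp r k) (γ : ℝ) :
    (fun n => u n / Real.log (u n) ^ γ) =Θ[atTop] logScale r (k - γ) 0 ∨
    (fun n => u n / Real.log (u n) ^ γ) =Θ[atTop] logScale r k (-γ) := by
  have hr0 : 0 < r := one_pos.trans_le hr
  have hlog0 : 0 ≤ᶠ[atTop] fun n => Real.log (u n) :=
    (Real.tendsto_log_atTop.comp hu).eventually_ge_atTop 0
  have hnat := tendsto_natCast_real_atTop
  have hlogn : Tendsto (fun n : ℕ => Real.log n) atTop atTop := Real.tendsto_log_atTop.comp hnat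
  rcases hr.eq_or_lt with rfl | hr1
  · right
    -- With `r = 1` and `k = 0` the sequence `u` would be bounded.
    have hk : (k : ℝ) ≠ 0 := by
      intro hk
      have hk' : k = 0 := by exact_mod_cast hk
      subst hk'
      have hb : u =O[atTop] fun _ => (1 : ℝ) := by
        refine hΘ.1.trans (IsBigO.of_bound 1 (Eventually.of_forall fun n => ?_))
        simp [powExp]
      obtain ⟨c, hc⟩ := hb.bound
      obtain ⟨n, hn, hn2⟩ := (hc.and (hu.eventually_gt_atTop c)).exists
      have := Real.le_norm_self (u n)
      simp only [norm_one, mul_one] at hn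
      linarith
    have h1 := isTheta_log_of_isTheta one_pos hΘ (hu.eventually_gt_atTop 0) hlogn (by
      simp only [Real.log_one, mul_zero, add_zero]
      exact (isTheta_const_mul_left hk).2 isTheta_rfl)
    have h2 := hΘ.div (h1.rpow (r := γ) hlog0 (hlogn.eventually_ge_atTop 0))
    refine h2.trans_eventuallyEq ?_
    filter_upwards [eventually_ge_atTop 2] with n hn
    have hl : 0 < Real.log n := Real.log_pos (by exact_mod_cast hn)
    simp only [powExp, logScale, Real.rpow_neg hl.le, Real.rpow_natCast]
    ring
  · left
    have hlr := Real.log_pos hr1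
    have h1 := isTheta_log_of_isTheta hr0 hΘ (hu.eventually_gt_atTop 0) hnat (by
      have hA : (fun n : ℕ => (n : ℝ) * Real.log r) =Θ[atTop] fun n : ℕ => (n : ℝ) := by
        simp_rw [mul_comm _ (Real.log r)]
        exact (isTheta_const_mul_left hlr.ne').2 isTheta_rfl
      have hB : (fun n : ℕ => (k : ℝ) * Real.log n) =o[atTop] fun n : ℕ => (n : ℝ) :=
        (Real.isLittleO_log_id_atTop.comp_tendsto hnat).const_mul_left _
      have := hA.add_isLittleO hB
      rwa [add_comm] at this)
    have h2 := hΘ.div (h1.rpow (r := γ) hlog0 (hnat.eventually_ge_atTop 0))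
    refine h2.trans_eventuallyEq ?_
    filter_upwards [eventually_ge_atTop 2] with n hn
    have hn' : (0 : ℝ) < n := by exact_mod_cast (by omega : 0 < n)
    simp only [powExp, logScale, Real.rpow_zero, Real.rpow_sub hn', Real.rpow_natCast]
    ring

theorem theorem1 {A : Type*} [Finite A] [DecidableEq A] (s : ℕ → A) (a : A) (γ C : ℝ)
    (hγ0 : 0 < γ) (hγ1 : γ < 1) (hC : 0 < C)
    (h : (fun N : ℕ => (letterCount a (prefixWord s N) : ℝ)) ~[atTop]
      (fun N : ℕ => C * ((N : ℝ) / (Real.log (N : ℝ)) ^ γ))) :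
    ¬ IsMorphic s := by
  rintro ⟨B, _, b, w, φ, ψ, -, hψ, hb, hs⟩
  set L : ℕ → ℕ := fun n => ((⇑φ)^[n] (FreeMonoid.of b)).length with hL
  have hLmono : Monotone L := monotone_length_iterate hb
  have hLtop : Tendsto L atTop atTop := tendsto_length_iterate hψ hb hs
  have hL1 : ∀ n, 1 ≤ L n := fun n => hLmono (Nat.zero_le n)
  -- `prefixWord s N` has length `N + 1`, so the iterate of length `L n` is the prefix with last
  -- index `L n - 1`.
  set u : ℕ → ℝ := fun n => ((L n - 1 : ℕ) : ℝ) with hu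
  have hNtop : Tendsto (fun n => L n - 1) atTop atTop := (tendsto_sub_atTop_nat 1).comp hLtop
  have hutop : Tendsto u atTop atTop := tendsto_natCast_real_atTop.comp hNtop
  obtain ⟨r, hr, k, hΘ⟩ : ∃ r : ℝ, 1 ≤ r ∧ ∃ k : ℕ, u =Θ[atTop] powExp r k := by
    rcases iterate_eventually_zero_or_growth φ b FreeMonoid.length (by simp) (by simp) with
      h0 | ⟨r, hr, k, hO, d, c, hc, hwin⟩
    · obtain ⟨n, hn⟩ := h0.exists
      exact absurd (hL1 n) (by simp [hL, hn])
    · obtain ⟨hr1, hΘ⟩ := isTheta_powExp_of_monotone (f := fun n => (L n : ℝ))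
        (Nat.mono_cast.comp hLmono) (fun n => by exact_mod_cast hL1 n)
        hr hO hc hwin
      refine ⟨r, hr1, k, IsTheta.trans ⟨IsBigO.of_bound 1 ?_, IsBigO.of_bound 2 ?_⟩ hΘ⟩
      · refine Eventually.of_forall fun n => ?_
        simp only [hu, Real.norm_natCast, one_mul]
        exact_mod_cast Nat.sub_le _ _
      · filter_upwards [hLtop.eventually_ge_atTop 2] with n hn
        simp only [hu, Real.norm_natCast]
        exact_mod_cast (by omega : L n ≤ 2 * (L n - 1))
  set f : ℕ → ℝ := fun n => (letterCount a (ψ ((⇑φ)^[n] (FreeMonoid.of b))) : ℝ) with hf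
  have hfeq : ∀ n, f n = (letterCount a (prefixWord s (L n - 1)) : ℝ) := by
    intro n
    simp only [hf, letterCount, prefixWord, toList_eq_map_range_of_wordsTendsto hψ hb hs n,
      Nat.sub_add_cancel (hL1 n), FreeMonoid.toList_ofList]
    rfl
  have hfΘ : f =Θ[atTop] fun n => u n / Real.log (u n) ^ γ := by
    have h1 := (h.comp_tendsto hNtop).isTheta
    rw [funext hfeq]
    exact h1.trans ((isTheta_const_mul_left hC.ne').2 isTheta_rfl)
  have hr0 : 0 < r := one_pos.trans_le hr
  rcases iterate_eventually_zero_or_growth φ b (fun v => letterCount a (ψ v))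
      (by simp [letterCount]) (by simp [letterCount]) with
    h0 | ⟨μ, hμ, j, hO, d, c, hc, hwin⟩
  · have hf0 : ∀ᶠ n in atTop, f n = 0 := by
      filter_upwards [h0] with n hn
      simp [hf, hn]
    have h2 := isBigO_iff.1 hfΘ.2
    obtain ⟨K, hK⟩ := h2
    obtain ⟨n, hn, hn0, hn1⟩ := (hK.and (hf0.and (hutop.eventually_gt_atTop 1))).exists
    rw [hn0, norm_zero, mul_zero, norm_le_zero_iff] at hn
    have hlog := Real.log_pos hn1
    have : 0 < u n / Real.log (u n) ^ γ := by positivity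
    exact this.ne' hn
  · have hfreq : ∃ᶠ n in atTop, c * logScale μ j 0 n ≤ ‖f n‖ := by
      refine frequently_atTop.2 fun n₀ => ?_
      obtain ⟨n, hn, hnn⟩ := (hwin.and (eventually_ge_atTop n₀)).exists
      obtain ⟨m, hnm, -, hm⟩ := hn
      refine ⟨m, hnn.trans hnm, ?_⟩
      rw [← powExp_eq_logScale]
      simpa [hf] using hm
    rw [powExp_eq_logScale] at hO
    -- Equality of scales gives `j = k - γ`, strictly between consecutive integers, or `0 = -γ`.
    rcases isTheta_div_log_rpow hutop hr hΘ γ with h1 | h1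
    · obtain ⟨-, hkj, -⟩ := logScale_unique hr0 hμ (hfΘ.trans h1) hO hc hfreq
      have h3 : (j : ℝ) < k := by linarith
      have h4 : (k : ℝ) < j + 1 := by linarith
      norm_cast at h3 h4
      omega
    · obtain ⟨-, -, hγ⟩ := logScale_unique hr0 hμ (hfΘ.trans h1) hO hc hfreq
      linarith
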